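/- For an integer $r\ge 3$, an $r$-graph on $[n]=\{1,\dots,n\}$ is a set of $r$-element subsets of $[n]$, called edges. It is linear if any two distinct edges share at most one vertex. The linear $4$-cycle $C_4^r$ is the $r$-graph with four distinct edges $e_1,e_2,e_3,e_4$ such that $|e_1\cap e_2|=|e_2\cap e_3|=|e_3\cap e_4|=|e_4\cap e_1|=1$ and $e_1\cap e_3=e_2\cap e_4=\emptyset$. Let $\mathrm{Forb}_L(n,C_4^r)$ denote the set of linear $r$-graphs on the vertex set $[n]$ that contain no $C_4^r$ as a (not necessarily induced) subgraph. **Theorem.** For every $r\ge 3$ there exists a constant $C=C(r)>0$ such that, for every $n$, $$|\mathrm{Forb}_L(n,C_4^r)|\le 2^{Cn^{3/2}}.$$ -/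

import Mathlib

/-- An `r`-uniform hypergraph (`r`-graph) on the vertex set `V`: a finite set of edges, each of
which is an `r`-element subset of `V`. -/
@[ext]
structure RGraph (r : ℕ) (V : Type*) where
  /-- The edges. -/
  edges : Finset (Finset V)
  /-- Every edge has exactly `r` elements. -/
  uniform : ∀ e ∈ edges, e.card = r

namespace RGraph

/-- An `r`-graph is linear if any two distinct edges share at most one vertex. -/
def IsLinear {r : ℕ} {V : Type*} [DecidableEq V] (H : RGraph r V) : Prop :=
  ∀ e ∈ H.edges, ∀ f ∈ H.edges, e ≠ f → (e ∩ f).card ≤ 1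

/-- The sets `e 0, …, e (ℓ - 1)` are, in this cyclic order, the edges of a linear cycle of length
`ℓ` (for `ℓ ≥ 4`): they are distinct, cyclically consecutive ones share exactly one vertex, and
all other pairs are disjoint. Here `finRotate ℓ` is the map `i ↦ i + 1` modulo `ℓ`. -/
def IsLinearCycle {V : Type*} [DecidableEq V] {ℓ : ℕ} (e : Fin ℓ → Finset V) : Prop :=
  Function.Injective e ∧
  (∀ i, (e i ∩ e (finRotate ℓ i)).card = 1) ∧
  (∀ i j, i ≠ j → j ≠ finRotate ℓ i → i ≠ finRotate ℓ j → e i ∩ e j = ∅)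

/-- The `r`-graph `H` contains the `r`-uniform linear cycle of length `ℓ` as a (not necessarily
induced) subgraph. -/
def ContainsLinearCycle {r : ℕ} {V : Type*} [DecidableEq V] (H : RGraph r V) (ℓ : ℕ) : Prop :=
  ∃ e : Fin ℓ → Finset V, (∀ i, e i ∈ H.edges) ∧ IsLinearCycle e

/-- There are finitely many `r`-graphs on a finite vertex set. -/
instance {r : ℕ} {V : Type*} [Finite V] : Finite (RGraph r V) :=
  Finite.of_injective RGraph.edges fun _ _ h => RGraph.ext h

/-- The set of linear `r`-graphs on `n` labelled vertices that contain no `r`-uniform linear cycle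
of length `ℓ`. -/
def ForbL (n r ℓ : ℕ) : Set (RGraph r (Fin n)) :=
  {H | H.IsLinear ∧ ¬ H.ContainsLinearCycle ℓ}

end RGraph

/-! Each hypergraph is encoded by a number of C₄-free graphs depending only on r, and these are
counted by the Kleitman–Winston method.

Encoding. Without linear four-cycles, only O(r²) two-edge paths join two given vertices
(`card_pathPairs_le`). Hence an edge shares triangles with at most 2r⁴ others, and a greedy
colouring with 2r⁴ + 1 colours leaves no monochromatic triangle. Inside a colour class, picking one
vertex pair from each edge gives a C₄-free graph (`c4Free_fromRel`), since a four-cycle would lift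
to a linear one. The r² picks by position together give the shadow of the class, whose r-cliques are
edges (`mem_of_clique`).

Counting. Delete a vertex of minimum degree from a C₄-free graph. Its neighbourhood is independent
in the graph that joins vertices with a common neighbour. That graph is so dense on large sets
(`exists_many_cherries`) that only exp(O(√n)) neighbourhoods can occur (`card_indepSets_le`,
`card_extensions_le`). Restoring n vertices one by one gives exp(O(n^(3/2))). -/

/-! ### Independent sets in locally dense graphs -/

open Finset in
/-- In a graph in which every set of more than `R` vertices contains a vertex adjacent to a
proportion `β` of the set, the number of independent sets of a given size is small. -/
theorem card_indepSets_le {V : Type*} [DecidableEq V] (Q : V → V → Prop) [DecidableRel Q]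
    {β R M m : ℝ} (d : ℕ)
    (hQ : ∀ A : Finset V, R < #A → ∃ y ∈ A, β * #A ≤ #{z ∈ A | Q y z})
    (hM : ∀ j ≤ d, ∀ a : ℕ, (a : ℝ) ≤ R → (a.choose j : ℝ) ≤ M) (hM1 : 0 ≤ M) (hm : 0 ≤ m)
    (k : ℕ) : ∀ j ≤ d, ∀ A : Finset V, #A ≤ R * Real.exp (β * k) → (#A : ℝ) ≤ m →
      (#{N ∈ A.powersetCard j | ∀ y ∈ N, ∀ z ∈ N, ¬ Q y z} : ℝ)
        ≤ (m + 1) ^ k * M := by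
  have small : ∀ j ≤ d, ∀ A : Finset V, #A ≤ R →
      (#{N ∈ A.powersetCard j | ∀ y ∈ N, ∀ z ∈ N, ¬ Q y z} : ℝ) ≤ M := by
    intro j hj A hA
    refine le_trans ?_ (hM j hj _ hA)
    rw [← card_powersetCard]
    exact_mod_cast card_filter_le _ _
  induction k with
  | zero =>
    intro j hj A hA _
    simpa using small j hj A (by simpa using hA)
  | succ k ih =>
    -- Inner induction on |A|. Sets avoiding the dense vertex y live in A \ {y}; sets containing y
    -- cost one unit of k. The second case arises at most |A| ≤ m times, whence the factor m + 1.
    have key : ∀ a : ℕ, ∀ j ≤ d, ∀ A : Finset V, #A = a → #A ≤ R * Real.exp (β * (k + 1 : ℕ)) →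
        (#A : ℝ) ≤ m →
        (#{N ∈ A.powersetCard j | ∀ y ∈ N, ∀ z ∈ N, ¬ Q y z} : ℝ)
          ≤ M + a * ((m + 1) ^ k * M) := by
      intro a
      induction a with
      | zero =>
        intro j hj A hA h1 _
        have hR : 0 ≤ R := by
          rw [hA] at h1
          exact nonneg_of_mul_nonneg_left (by simpa using h1) (Real.exp_pos _)
        simpa using small j hj A (by simpa [hA] using hR)
      | succ a iha =>
        intro j hj A hA h1 h2
        have hpos : 0 ≤ ((a + 1 : ℕ) : ℝ) * ((m + 1) ^ k * M) := by positivity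
        by_cases hAR : (#A : ℝ) ≤ R
        · linarith [small j hj A hAR]
        obtain ⟨y, hyA, hy⟩ := hQ A (not_le.1 hAR)
        have hle : #(A.erase y) ≤ #A := card_le_card (erase_subset _ _)
        have hle' : (#(A.erase y) : ℝ) ≤ #A := by exact_mod_cast hle
        have e1 := iha j hj (A.erase y) (by rw [card_erase_of_mem hyA]; omega)
          (hle'.trans h1) (hle'.trans h2)
        -- An independent set containing y has its other elements in B, and |B| ≤ (1 - β)|A| ≤
        -- exp(-β)|A|.
        set B := {z ∈ A.erase y | ¬ Q y z} with hB
        have hBc : (#B : ℝ) ≤ #A - β * #A := by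
          have : #B + #{z ∈ A | Q y z} ≤ #A := by
            rw [← card_filter_add_card_filter_not (s := A) (Q y), add_comm]
            gcongr
            exact filter_subset_filter _ (erase_subset _ _)
          have : (#B : ℝ) + #{z ∈ A | Q y z} ≤ #A := by exact_mod_cast this
          linarith
        have hB2 : (#B : ℝ) ≤ R * Real.exp (β * k) := by
          have h3 : (#A : ℝ) - β * #A ≤ #A * Real.exp (-β) := by
            nlinarith [Real.add_one_le_exp (-β), (Nat.cast_nonneg #A : (0 : ℝ) ≤ #A)]
          have h4 : #A * Real.exp (-β) ≤ R * Real.exp (β * (k + 1 : ℕ)) * Real.exp (-β) := by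
            gcongr
          rw [mul_assoc, ← Real.exp_add] at h4
          have : β * ((k + 1 : ℕ) : ℝ) + -β = β * k := by push_cast; ring
          rw [this] at h4
          linarith
        have hBA : (#B : ℝ) ≤ m := by
          have : #B ≤ #A := (card_filter_le _ _).trans hle
          exact le_trans (by exact_mod_cast this) h2
        have e2 : (#{N ∈ A.powersetCard j | (∀ y ∈ N, ∀ z ∈ N, ¬ Q y z) ∧ y ∈ N} : ℝ)
            ≤ (m + 1) ^ k * M := by
          rcases j with _ | j
          · have : {N ∈ A.powersetCard 0 | (∀ y ∈ N, ∀ z ∈ N, ¬ Q y z) ∧ y ∈ N} = ∅ := by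
              ext N
              simp +contextual
            rw [this]
            simp only [card_empty, Nat.cast_zero]
            positivity
          · refine le_trans ?_ (ih j (by omega) B hB2 hBA)
            norm_cast
            refine card_le_card_of_injOn (fun N => N.erase y) ?_ ?_
            · intro N hN
              simp only [coe_filter, mem_powersetCard, Set.mem_ofPred_eq] at hN ⊢
              obtain ⟨⟨hNA, hNc⟩, hNi, hyN⟩ := hN
              refine ⟨⟨?_, by rw [card_erase_of_mem hyN]; omega⟩, ?_⟩
              · intro z hz
                rw [hB, mem_filter]
                exact ⟨erase_subset_erase _ hNA hz, hNi y hyN z (mem_of_mem_erase hz)⟩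
              · exact fun z hz w hw => hNi z (mem_of_mem_erase hz) w (mem_of_mem_erase hw)
            · intro N hN N' hN' h
              simp only [coe_filter, Set.mem_ofPred_eq] at hN hN' h
              rw [← insert_erase hN.2.2, ← insert_erase hN'.2.2, h]
        have e3 : #{N ∈ A.powersetCard j | ∀ y ∈ N, ∀ z ∈ N, ¬ Q y z} ≤
            #{N ∈ (A.erase y).powersetCard j | ∀ y ∈ N, ∀ z ∈ N, ¬ Q y z} +
            #{N ∈ A.powersetCard j | (∀ y ∈ N, ∀ z ∈ N, ¬ Q y z) ∧ y ∈ N} := by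
          refine le_trans (card_le_card ?_) (card_union_le _ _)
          intro N hN
          simp only [mem_union, mem_filter, mem_powersetCard] at hN ⊢
          by_cases hyN : y ∈ N
          · right; tauto
          · left
            exact ⟨⟨subset_erase.2 ⟨hN.1.1, hyN⟩, hN.1.2⟩, hN.2⟩
        have e3' : (#{N ∈ A.powersetCard j | ∀ y ∈ N, ∀ z ∈ N, ¬ Q y z} : ℝ) ≤
            #{N ∈ (A.erase y).powersetCard j | ∀ y ∈ N, ∀ z ∈ N, ¬ Q y z} +
            #{N ∈ A.powersetCard j | (∀ y ∈ N, ∀ z ∈ N, ¬ Q y z) ∧ y ∈ N} := by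
          exact_mod_cast e3
        push_cast
        linarith
    intro j hj A hA hAm
    refine (key _ j hj A rfl hA hAm).trans ?_
    have h1 : (1 : ℝ) ≤ (m + 1) ^ k := one_le_pow₀ (by linarith)
    have h2 : #A * ((m + 1) ^ k * M) ≤ m * ((m + 1) ^ k * M) := by gcongr
    have h3 : 1 * M ≤ (m + 1) ^ k * M := by gcongr
    rw [pow_succ]
    linarith

/-! ### One-vertex extensions of C₄-free graphs -/

/-- A graph without cycles of length four: any two vertices have at most one common neighbour. -/
def SimpleGraph.C4Free {V : Type*} (G : SimpleGraph V) : Prop :=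
  ∀ a c b d, a ≠ c → G.Adj a b → G.Adj c b → G.Adj a d → G.Adj c d → b = d

open Finset in
/-- In a `C₄`-free graph of minimum degree at least `D`, every large vertex set contains a vertex
that has a common neighbour with many others of the set. -/
theorem SimpleGraph.C4Free.exists_many_cherries {V : Type*} [Fintype V] [DecidableEq V]
    {G : SimpleGraph V} [DecidableRel G.Adj] (hG : G.C4Free) {D : ℕ} (hD : ∀ v, D ≤ G.degree v)
    (A : Finset V) (hA : 2 * (Fintype.card V : ℝ) < D * #A) :
    ∃ y ∈ A, (D : ℝ) ^ 2 / (2 * Fintype.card V) * #A ≤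
      #{z ∈ A | y ≠ z ∧ ∃ x, G.Adj x y ∧ G.Adj x z} := by
  set m : ℝ := (Fintype.card V : ℝ) with hm
  have hm0 : 0 ≤ m := by positivity
  have hApos : 0 < #A := by
    rcases Nat.eq_zero_or_pos #A with h | h
    · rw [h] at hA; simp at hA; linarith
    · exact h
  obtain ⟨v, hv⟩ := card_pos.1 hApos
  have hmpos : 0 < m := by
    have : 0 < Fintype.card V := Fintype.card_pos_iff.2 ⟨v⟩
    rw [hm]
    exact_mod_cast this
  let a : V → ℝ := fun x => #{y ∈ A | G.Adj x y}
  have h1 : ∀ y ∈ A, ∑ x, (if G.Adj x y then a x - 1 else 0) ≤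
      (#{z ∈ A | y ≠ z ∧ ∃ x, G.Adj x y ∧ G.Adj x z} : ℝ) := by
    intro y hy
    -- By C₄-freeness the sets for different centres x are disjoint, so no z is counted twice.
    have hsub : (univ.filter fun x => G.Adj x y).biUnion (fun x => {z ∈ A | y ≠ z ∧ G.Adj x z}) ⊆
        {z ∈ A | y ≠ z ∧ ∃ x, G.Adj x y ∧ G.Adj x z} := by
      intro z
      simp only [mem_biUnion, mem_filter, mem_univ, true_and]
      rintro ⟨x, hx, hz, hyz, hxz⟩
      exact ⟨hz, hyz, x, hx, hxz⟩
    have := card_le_card hsub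
    rw [card_biUnion] at this
    · refine le_trans (le_of_eq ?_) (Nat.cast_le.2 this)
      rw [← sum_filter]
      push_cast
      refine sum_congr rfl fun x hx => ?_
      have hxy : G.Adj x y := (mem_filter.1 hx).2
      have : {z ∈ A | y ≠ z ∧ G.Adj x z} = ({z ∈ A | G.Adj x z}).erase y := by
        ext z; simp only [mem_filter, mem_erase]; tauto
      rw [this, card_erase_of_mem (by simp [hy, hxy]), Nat.cast_pred]
      exact card_pos.2 ⟨y, by simp [hy, hxy]⟩
    · intro x hx x' hx' hne
      rw [Function.onFun, Finset.disjoint_left]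
      intro z hz hz'
      simp only [coe_filter, mem_univ, true_and, Set.mem_ofPred_eq, mem_filter] at hx hx' hz hz'
      exact hz.2.1 (hG x x' y z hne hx hx' hz.2.2 hz'.2.2)
  have h2 : ∑ y ∈ A, ∑ x, (if G.Adj x y then a x - 1 else 0) = ∑ x, a x * (a x - 1) := by
    rw [sum_comm]
    refine sum_congr rfl fun x _ => ?_
    rw [← sum_filter, sum_const, nsmul_eq_mul]
  have h3 : (D : ℝ) * #A ≤ ∑ x, a x := by
    have : ∑ x, #{y ∈ A | G.Adj x y} = ∑ y ∈ A, G.degree y := by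
      have e : ∀ y, G.degree y = ∑ x, if G.Adj x y then 1 else 0 := by
        intro y
        rw [← card_filter, ← G.card_neighborFinset_eq_degree]
        congr 1
        ext x
        simp [G.adj_comm]
      simp_rw [e, card_filter]
      exact sum_comm
    have h' : #A * D ≤ ∑ y ∈ A, G.degree y := by
      rw [← smul_eq_mul]
      exact card_nsmul_le_sum _ _ _ fun y _ => hD y
    rw [← this] at h'
    have : ((#A * D : ℕ) : ℝ) ≤ ((∑ x, #{y ∈ A | G.Adj x y} : ℕ) : ℝ) := by exact_mod_cast h'
    push_cast at this
    linarith
  have h4 : (∑ x, a x) ^ 2 ≤ m * ∑ x, a x ^ 2 := by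
    simpa [hm] using sq_sum_le_card_mul_sum_sq (s := (univ : Finset V)) (f := a)
  by_contra! hcon
  have h5 : ∑ x, a x * (a x - 1) < ∑ _y ∈ A, (D : ℝ) ^ 2 / (2 * m) * #A := by
    rw [← h2]
    refine sum_lt_sum_of_nonempty ⟨v, hv⟩ fun y hy => (h1 y hy).trans_lt (hcon y hy)
  rw [sum_const, nsmul_eq_mul] at h5
  have h6 : ∑ x, a x * (a x - 1) = ∑ x, a x ^ 2 - ∑ x, a x := by
    rw [← sum_sub_distrib]
    exact sum_congr rfl fun x _ => by ring
  rw [h6] at h5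
  set S := ∑ x, a x
  have h7 : m * (∑ x, a x ^ 2 - S) < (D * #A) ^ 2 / 2 := by
    calc _ < m * (#A * ((D : ℝ) ^ 2 / (2 * m) * #A)) := by gcongr
      _ = _ := by field_simp
  -- S ≥ D|A| > 2m, so Cauchy–Schwarz gives m(∑ a² - S) ≥ S² - mS ≥ S²/2 ≥ (D|A|)²/2, against `h7`.
  nlinarith

/-- A subexponential bound for the binomial coefficients met by the container argument. -/
theorem choose_le_exp_sqrt {m D : ℝ} (hm : 0 < m) (hD : 1 ≤ D) {a j : ℕ} (ha : (a : ℝ) ≤ 2 * m / D)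
    (hj : (j : ℝ) ≤ 2 * D) : (a.choose j : ℝ) ≤ Real.exp (4 * √m) := by
  have hs : 0 < √m := Real.sqrt_pos.2 hm
  have hss : √m * √m = m := Real.mul_self_sqrt hm.le
  by_cases hx : √m ≤ D
  · have h1 : (a.choose j : ℝ) ≤ 2 ^ a := by exact_mod_cast Nat.choose_le_two_pow a j
    refine h1.trans ?_
    have h2 : (2 : ℝ) ≤ Real.exp 1 := by linarith [Real.add_one_le_exp 1]
    refine (pow_le_pow_left₀ (by norm_num) h2 a).trans ?_
    rw [← Real.exp_nat_mul]
    refine Real.exp_le_exp.2 ?_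
    have : 2 * m / D ≤ 2 * √m := by
      rw [div_le_iff₀ (by linarith)]
      nlinarith
    linarith
  · push Not at hx
    -- This weight balances the binomial theorem: (1 + x)^a ≤ exp(ax) and x^(-j) ≤ exp(j/x) are both
    -- at most exp(2√m).
    set x := D / √m with hxdef
    have hx0 : 0 < x := by positivity
    have h1 : (a.choose j : ℝ) * x ^ j ≤ Real.exp (2 * √m) := by
      by_cases hja : j ≤ a
      · have h2 : x ^ j * 1 ^ (a - j) * (a.choose j : ℝ) ≤ (x + 1) ^ a := by
          rw [add_pow]
          exact Finset.single_le_sum (f := fun i => x ^ i * 1 ^ (a - i) * (a.choose i : ℝ))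
            (fun i _ => by positivity) (Finset.mem_range.2 (by omega))
        have h3 : (x + 1) ^ a ≤ Real.exp (2 * √m) := by
          refine (pow_le_pow_left₀ (by positivity) (Real.add_one_le_exp x) a).trans ?_
          rw [← Real.exp_nat_mul]
          refine Real.exp_le_exp.2 ?_
          calc (a : ℝ) * x ≤ 2 * m / D * x := by gcongr
            _ = 2 * m / √m := by rw [hxdef]; field_simp
            _ = 2 * √m := by rw [div_eq_iff hs.ne']; linarith
        have h4 : (a.choose j : ℝ) * x ^ j = x ^ j * 1 ^ (a - j) * (a.choose j : ℝ) := by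
          rw [one_pow]; ring
        linarith
      · rw [Nat.choose_eq_zero_of_lt (by omega)]
        simp [Real.exp_nonneg]
    have h5 : (x⁻¹) ^ j ≤ Real.exp (2 * √m) := by
      have h6 : x⁻¹ ≤ Real.exp (x⁻¹) := by linarith [Real.add_one_le_exp (x⁻¹)]
      refine (pow_le_pow_left₀ (by positivity) h6 j).trans ?_
      rw [← Real.exp_nat_mul]
      refine Real.exp_le_exp.2 ?_
      calc (j : ℝ) * x⁻¹ ≤ 2 * D * x⁻¹ := by gcongr
        _ = 2 * √m := by rw [hxdef]; field_simp
    calc (a.choose j : ℝ) = (a.choose j : ℝ) * x ^ j * (x⁻¹) ^ j := by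
          rw [mul_assoc, ← mul_pow, mul_inv_cancel₀ hx0.ne', one_pow, mul_one]
      _ ≤ Real.exp (2 * √m) * Real.exp (2 * √m) := by gcongr
      _ = Real.exp (4 * √m) := by rw [← Real.exp_add]; ring_nf

/-- The container argument puts a fourth power of the logarithm in the exponent. Here log x ≤
8x^(1/8), and 8⁴ = 4096. -/
theorem log_pow_four_le {x : ℝ} (hx : 1 ≤ x) : Real.log x ^ 4 ≤ 4096 * √x := by
  have h := Real.log_le_rpow_div (x := x) (by linarith) (ε := 1 / 8) (by norm_num)
  have h0 : 0 ≤ Real.log x := Real.log_nonneg hx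
  calc Real.log x ^ 4 ≤ (x ^ (1 / 8 : ℝ) / (1 / 8)) ^ 4 := by gcongr
    _ = 4096 * (x ^ (1 / 8 : ℝ)) ^ 4 := by ring
    _ = 4096 * √x := by
      rw [← Real.rpow_natCast, ← Real.rpow_mul (by linarith), Real.sqrt_eq_rpow]
      norm_num

theorem log_le_two_mul_sqrt {x : ℝ} (hx : 0 ≤ x) : Real.log x ≤ 2 * √x := by
  have h := Real.log_le_rpow_div hx (ε := 1 / 2) (by norm_num)
  rw [← Real.sqrt_eq_rpow] at h
  linarith

open Finset in
/-- The number of sets of size `d` that may be joined to a new vertex without creating a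
four-cycle, in a `C₄`-free graph of minimum degree at least `d - 1`. -/
theorem SimpleGraph.C4Free.card_extensions_le {V : Type*} [Fintype V] [DecidableEq V]
    {G : SimpleGraph V} [DecidableRel G.Adj] (hG : G.C4Free) {d : ℕ}
    (hd : ∀ v, d ≤ G.degree v + 1) :
    (#{N ∈ (univ : Finset V).powersetCard d | ∀ y ∈ N, ∀ z ∈ N,
      ¬ (y ≠ z ∧ ∃ x, G.Adj x y ∧ G.Adj x z)} : ℝ) ≤
      Real.exp (9000 * √(Fintype.card V + 1)) := by
  set m : ℝ := (Fintype.card V : ℝ) with hm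
  have hm0 : 0 ≤ m := by positivity
  set s := √(m + 1) with hs
  set L := Real.log (m + 1) with hL
  have hL0 : 0 ≤ L := Real.log_nonneg (by linarith)
  have hLs : L ≤ 2 * s := log_le_two_mul_sqrt (by linarith)
  have hL4 : L ^ 4 ≤ 4096 * s := log_pow_four_le (by linarith)
  have hs0 : 0 < s := Real.sqrt_pos.2 (by linarith)
  have hexpL : Real.exp L = m + 1 := Real.exp_log (by linarith)
  set D := d - 1 with hDdef
  -- For small D, including d = 0, the trivial bound m^d suffices; otherwise m ≤ (DL)², which keeps
  -- the number k of container steps small.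
  by_cases hcase : (D : ℝ) * L ≤ s
  · calc (#{N ∈ (univ : Finset V).powersetCard d | ∀ y ∈ N, ∀ z ∈ N,
      ¬ (y ≠ z ∧ ∃ x, G.Adj x y ∧ G.Adj x z)} : ℝ)
          ≤ #((univ : Finset V).powersetCard d) := by exact_mod_cast card_filter_le _ _
      _ = ((Fintype.card V).choose d : ℝ) := by rw [card_powersetCard, card_univ]
      _ ≤ m ^ d := by rw [hm]; exact_mod_cast Nat.choose_le_pow _ _
      _ ≤ (m + 1) ^ d := by gcongr; linarith
      _ = Real.exp (d * L) := by rw [Real.exp_nat_mul, hexpL]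
      _ ≤ Real.exp (9000 * s) := by
        refine Real.exp_le_exp.2 ?_
        have : (d : ℝ) ≤ D + 1 := by
          have : d ≤ D + 1 := by omega
          exact_mod_cast this
        nlinarith
  push Not at hcase
  have hDpos : 1 ≤ D := by
    rcases Nat.eq_zero_or_pos D with h | h
    · rw [h] at hcase; simp at hcase; linarith
    · exact h
  have hD1 : (1 : ℝ) ≤ D := by exact_mod_cast hDpos
  have hLpos : 0 < L := by
    rcases hL0.lt_or_eq with h | h
    · exact h
    · rw [← h] at hcase; simp at hcase; linarith
  have hmpos : 0 < m := by
    rcases hm0.lt_or_eq with h | h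
    · exact h
    · rw [hL, ← h] at hLpos; simp at hLpos
  have hV : Nonempty V := by
    rw [← Fintype.card_pos_iff]; rw [hm] at hmpos; exact_mod_cast hmpos
  have hDm : (D : ℝ) ≤ m := by
    obtain ⟨v⟩ := hV
    have h1 := hd v
    have h2 := G.degree_lt_card_verts v
    have : D ≤ Fintype.card V := by omega
    rw [hm]
    exact_mod_cast this
  set β : ℝ := (D : ℝ) ^ 2 / (2 * m) with hβ
  have hβ0 : 0 < β := by positivity
  set R : ℝ := 2 * m / D with hR
  have hR1 : 1 ≤ R := by rw [hR, le_div_iff₀ (by linarith)]; linarith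
  -- Enough steps for exp(βk) ≥ m + 1, so that the whole vertex set meets the size condition.
  set k := ⌈L / β⌉₊ with hk
  have hk1 : L ≤ β * k := by
    have := Nat.le_ceil (L / β)
    rw [div_le_iff₀ hβ0] at this
    linarith
  have hk2 : (k : ℝ) < L / β + 1 := Nat.ceil_lt_add_one (by positivity)
  have hmain := card_indepSets_le (V := V) (fun y z => y ≠ z ∧ ∃ x, G.Adj x y ∧ G.Adj x z)
    (β := β) (R := R) (M := Real.exp (4 * s)) (m := m) d
    (fun A hA => hG.exists_many_cherries (D := D) (fun v => by have := hd v; omega) A (by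
      rw [hR, div_lt_iff₀ (by linarith)] at hA
      linarith))
    (fun j hj a ha => (choose_le_exp_sqrt hmpos hD1 ha (by
      have : j ≤ 2 * D := by omega
      exact_mod_cast this)).trans (by
        refine Real.exp_le_exp.2 ?_
        have : √m ≤ s := Real.sqrt_le_sqrt (by linarith)
        linarith))
    (Real.exp_nonneg _) hm0 k d le_rfl univ (by
      rw [card_univ]
      calc m ≤ 1 * Real.exp L := by rw [hexpL]; linarith
        _ ≤ R * Real.exp (β * k) := by gcongr) (by rw [card_univ])
  refine (le_of_eq (by congr!)).trans (hmain.trans ?_)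
  rw [← hexpL, ← Real.exp_nat_mul, ← Real.exp_add]
  refine Real.exp_le_exp.2 ?_
  -- The exponent kL + 4s is at most 2L⁴ + L + 4s ≤ (8192 + 2 + 4)s, which fits under 9000s.
  have h1 : L / β * L ≤ 2 * L ^ 4 := by
    rw [hβ, div_mul_eq_mul_div, div_le_iff₀ (by positivity)]
    have h2 : m ≤ (D * L) ^ 2 := by
      have : s ^ 2 = m + 1 := Real.sq_sqrt (by linarith)
      nlinarith
    have h3 : 2 * L ^ 4 * ((D : ℝ) ^ 2 / (2 * m)) = L * L * ((D * L) ^ 2 / m) := by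
      field_simp
    rw [h3]
    have h4 : 1 ≤ (D * L) ^ 2 / m := by rw [le_div_iff₀ hmpos]; linarith
    nlinarith [mul_pos hLpos hLpos]
  nlinarith

open Finset in
open scoped Classical in
/-- The neighbourhoods of a new vertex of minimum degree that create no four-cycle. -/
noncomputable def SimpleGraph.extensions {n : ℕ} (G : SimpleGraph (Fin n)) :
    Finset (Finset (Fin n)) :=
  {N | (∀ v, #N ≤ G.degree v + 1) ∧
    ∀ y ∈ N, ∀ z ∈ N, ¬ (y ≠ z ∧ ∃ x, G.Adj x y ∧ G.Adj x z)}

open Finset in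
open scoped Classical in
theorem SimpleGraph.mem_extensions {n : ℕ} {G : SimpleGraph (Fin n)} {N : Finset (Fin n)} :
    N ∈ G.extensions ↔ (∀ v, #N ≤ G.degree v + 1) ∧
      ∀ y ∈ N, ∀ z ∈ N, ¬ (y ≠ z ∧ ∃ x, G.Adj x y ∧ G.Adj x z) := by
  simp [extensions]

-- Splitting by the size of the new neighbourhood, which takes at most n + 1 values, costs only a
-- linear factor.
open Finset in
open scoped Classical in
theorem SimpleGraph.C4Free.card_extensions_le_exp {n : ℕ} {G : SimpleGraph (Fin n)}
    (hG : G.C4Free) : (#G.extensions : ℝ) ≤ (n + 1) * Real.exp (9000 * √(n + 1)) := by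
  have h1 : #G.extensions ≤ ∑ d ∈ range (n + 1), #{N ∈ G.extensions | #N = d} := by
    rw [← card_eq_sum_card_fiberwise]
    intro N _
    have := card_le_univ N
    simp at this
    simp; omega
  have h2 : ∀ d ∈ range (n + 1), (#{N ∈ G.extensions | #N = d} : ℝ) ≤
      Real.exp (9000 * √(n + 1)) := by
    intro d _
    by_cases hd : ∀ v, d ≤ G.degree v + 1
    · have := hG.card_extensions_le hd
      rw [Fintype.card_fin] at this
      refine le_trans ?_ this
      norm_cast
      refine card_le_card fun N hN => ?_
      simp only [mem_filter, mem_extensions] at hN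
      simp only [mem_filter, mem_powersetCard, subset_univ, true_and]
      exact ⟨hN.2, hN.1.2⟩
    · have : {N ∈ G.extensions | #N = d} = ∅ := by
        refine filter_eq_empty_iff.2 fun N hN hNd => hd ?_
        simp only [mem_extensions] at hN
        exact hNd ▸ hN.1
      rw [this]
      simp [Real.exp_nonneg]
  calc (#G.extensions : ℝ) ≤ ∑ d ∈ range (n + 1), (#{N ∈ G.extensions | #N = d} : ℝ) := by
        exact_mod_cast h1
    _ ≤ ∑ d ∈ range (n + 1), Real.exp (9000 * √(n + 1)) := sum_le_sum h2
    _ = (n + 1) * Real.exp (9000 * √(n + 1)) := by simp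

/-! ### Counting C₄-free graphs -/

open Finset in
open scoped Classical in
/-- Deleting a vertex of minimum degree encodes a `C₄`-free graph on `n + 1` vertices by a
`C₄`-free graph on `n` vertices and one of few possible neighbourhoods. -/
theorem card_c4Free_succ_le_sum (n : ℕ) :
    #{G : SimpleGraph (Fin (n + 1)) | G.C4Free} ≤
      (n + 1) * ∑ G : SimpleGraph (Fin n) with G.C4Free, #G.extensions := by
  have hmin : ∀ G : SimpleGraph (Fin (n + 1)), ∃ v, ∀ w, G.degree v ≤ G.degree w := fun G => by
    obtain ⟨v, hv⟩ := Finite.exists_min fun w => G.degree w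
    exact ⟨v, hv⟩
  choose v hv using hmin
  let nb : SimpleGraph (Fin (n + 1)) → Finset (Fin n) :=
    fun G => {w | G.Adj (v G) ((v G).succAbove w)}
  let φ : SimpleGraph (Fin (n + 1)) → Fin (n + 1) × (_ : SimpleGraph (Fin n)) × Finset (Fin n) :=
    fun G => (v G, ⟨G.comap (v G).succAbove, nb G⟩)
  have hnb : ∀ G, #(nb G) = G.degree (v G) := by
    intro G
    rw [← G.card_neighborFinset_eq_degree,
      ← card_map (s := nb G) (v G).succAboveEmb]
    congr 1
    ext x
    simp only [mem_map, nb, mem_filter, mem_univ, true_and, SimpleGraph.mem_neighborFinset]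
    constructor
    · rintro ⟨w, hw, rfl⟩
      exact hw
    · intro hx
      obtain ⟨w, rfl⟩ := Fin.exists_succAbove_eq hx.ne'
      exact ⟨w, hx, rfl⟩
  have hdeg : ∀ (G : SimpleGraph (Fin (n + 1))) (w : Fin n), G.degree ((v G).succAbove w) ≤
      (G.comap (v G).succAbove).degree w + 1 := by
    intro G w
    rw [← SimpleGraph.card_neighborFinset_eq_degree, ← SimpleGraph.card_neighborFinset_eq_degree,
      ← card_map (s := SimpleGraph.neighborFinset _ w) (v G).succAboveEmb]
    refine le_trans (card_le_card ?_) (card_insert_le (v G) _)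
    intro x hx
    rw [mem_insert]
    by_cases hxv : x = v G
    · exact Or.inl hxv
    · right
      obtain ⟨u, rfl⟩ := Fin.exists_succAbove_eq hxv
      exact mem_map.2 ⟨u, by simpa using hx, rfl⟩
  have hinj : Function.Injective φ := by
    intro G G' h
    simp only [φ, Prod.mk.injEq, Sigma.mk.injEq, heq_eq_eq] at h
    obtain ⟨h1, h2, h3⟩ := h
    have hN : ∀ w, G.Adj (v G) ((v G).succAbove w) ↔ G'.Adj (v G) ((v G).succAbove w) := by
      intro w
      have := congrArg (w ∈ ·) h3
      simpa [nb, ← h1] using this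
    have hC : ∀ w u, G.Adj ((v G).succAbove u) ((v G).succAbove w) ↔
        G'.Adj ((v G).succAbove u) ((v G).succAbove w) := by
      intro w u
      have := congrArg (fun K : SimpleGraph (Fin n) => K.Adj u w) h2
      simpa [← h1] using this
    ext x y
    by_cases hx : x = v G
    · by_cases hy : y = v G
      · simp [hx, hy]
      · obtain ⟨w, rfl⟩ := Fin.exists_succAbove_eq hy
        rw [hx, hN]
    · obtain ⟨u, rfl⟩ := Fin.exists_succAbove_eq hx
      by_cases hy : y = v G
      · rw [hy, G.adj_comm, G'.adj_comm, hN]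
      · obtain ⟨w, rfl⟩ := Fin.exists_succAbove_eq hy
        exact hC w u
  have hcard : #{G : SimpleGraph (Fin (n + 1)) | G.C4Free} ≤
      #((univ : Finset (Fin (n + 1))) ×ˢ
        (({G : SimpleGraph (Fin n) | G.C4Free} : Finset _).sigma fun G => G.extensions)) := by
    refine card_le_card_of_injOn φ ?_ hinj.injOn
    intro G hG
    simp only [coe_filter, mem_univ, true_and, Set.mem_ofPred_eq] at hG
    simp only [φ, coe_product, Set.mem_prod, mem_coe, mem_univ, true_and, mem_sigma, mem_filter,
      SimpleGraph.mem_extensions]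
    have hsa := (v G).succAbove_right_injective
    refine ⟨fun a c b d hac h1 h2 h3 h4 => hsa (hG _ _ _ _ (hsa.ne hac) h1 h2 h3 h4),
      fun w => ?_, ?_⟩
    · rw [hnb]
      exact (hv G _).trans (hdeg G w)
    · rintro y hy z hz ⟨hyz, x, hxy, hxz⟩
      simp only [nb, mem_filter, mem_univ, true_and] at hy hz
      -- Two neighbours of the deleted vertex with another common neighbour x would close a
      -- four-cycle.
      exact hyz (hsa (hG _ _ _ _ ((v G).succAbove_ne x).symm hy hxy hz hxz))
  rwa [card_product, card_sigma, card_univ, Fintype.card_fin] at hcard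

-- The deleted vertex and the size of its neighbourhood each contribute a factor n + 1 ≤ exp(2√(n +
-- 1)), so 9004 = 9000 + 2 + 2.
open Finset in
open scoped Classical in
theorem card_c4Free_succ_le (n : ℕ) :
    (#{G : SimpleGraph (Fin (n + 1)) | G.C4Free} : ℝ) ≤
      #{G : SimpleGraph (Fin n) | G.C4Free} * Real.exp (9004 * √(n + 1)) := by
  have hcard : (#{G : SimpleGraph (Fin (n + 1)) | G.C4Free} : ℝ) ≤
      (n + 1) * ∑ G : SimpleGraph (Fin n) with G.C4Free, (#G.extensions : ℝ) := by
    exact_mod_cast card_c4Free_succ_le_sum n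
  have hsum : ∑ G : SimpleGraph (Fin n) with G.C4Free, (#G.extensions : ℝ) ≤
      #{G : SimpleGraph (Fin n) | G.C4Free} * ((n + 1) * Real.exp (9000 * √(n + 1))) := by
    rw [← nsmul_eq_mul]
    exact sum_le_card_nsmul _ _ _ fun G hG => (mem_filter.1 hG).2.card_extensions_le_exp
  have hlin : (n + 1 : ℝ) ≤ Real.exp (2 * √(n + 1)) := by
    rw [← Real.log_le_iff_le_exp (by positivity)]
    exact log_le_two_mul_sqrt (by positivity)
  refine hcard.trans ((mul_le_mul_of_nonneg_left hsum (by positivity)).trans ?_)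
  have hsplit : 9004 * √((n : ℝ) + 1) = 2 * √(n + 1) + (2 * √(n + 1) + 9000 * √(n + 1)) := by
    ring
  rw [hsplit, Real.exp_add, Real.exp_add]
  have hc : (0 : ℝ) ≤ #{G : SimpleGraph (Fin n) | G.C4Free} := by positivity
  clear hsum hcard
  generalize (#{G : SimpleGraph (Fin n) | G.C4Free} : ℝ) = c at hc ⊢
  have hsq : ((n : ℝ) + 1) * (n + 1) ≤
      Real.exp (2 * √(n + 1)) * Real.exp (2 * √(n + 1)) := by gcongr
  calc _ = c * (((n : ℝ) + 1) * (n + 1) * Real.exp (9000 * √(n + 1))) := by ring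
    _ ≤ c * (Real.exp (2 * √(n + 1)) * Real.exp (2 * √(n + 1)) * Real.exp (9000 * √(n + 1))) := by
      gcongr
    _ = _ := by ring

open Finset in
open scoped Classical in
/-- The Kleitman–Winston theorem: there are `2 ^ O(n ^ (3 / 2))` graphs without four-cycles on `n`
labelled vertices. -/
theorem card_c4Free_le (n : ℕ) :
    (#{G : SimpleGraph (Fin n) | G.C4Free} : ℝ) ≤ Real.exp (9004 * (n : ℝ) ^ (3 / 2 : ℝ)) := by
  have key : ∀ k ≤ n, (#{G : SimpleGraph (Fin k) | G.C4Free} : ℝ) ≤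
      Real.exp (9004 * √n) ^ k := by
    intro k
    induction k with
    | zero =>
      intro _
      have h : #{G : SimpleGraph (Fin 0) | G.C4Free} ≤ 1 :=
        card_le_one.2 fun G _ G' _ => by ext a; exact a.elim0
      simpa using h
    | succ k ih =>
      intro hk
      refine (card_c4Free_succ_le k).trans ?_
      rw [pow_succ]
      have hk' : (k + 1 : ℝ) ≤ n := by exact_mod_cast hk
      have := ih (by omega)
      gcongr
  refine (key n le_rfl).trans (le_of_eq ?_)
  rw [← Real.exp_nat_mul]
  congr 1
  rcases Nat.eq_zero_or_pos n with rfl | hn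
  · norm_num
  · have : (n : ℝ) ^ (3 / 2 : ℝ) = n * √n := by
      rw [Real.sqrt_eq_rpow, ← Real.rpow_one_add' (by positivity) (by norm_num)]
      norm_num
    rw [this]
    ring

/-! ### Colouring away the triangles -/

/-- Greedy colouring of a finite symmetric relation of bounded degree. -/
theorem exists_greedy_coloring {α : Type*} [DecidableEq α] (R : α → α → Prop) [DecidableRel R]
    (hR : ∀ x y, R x y → R y x) (hirr : ∀ x, ¬ R x x) (D : ℕ) (s : Finset α)
    (hs : ∀ x ∈ s, (s.filter (R x)).card ≤ D) :
    ∃ col : α → Fin (D + 1), ∀ x ∈ s, ∀ y ∈ s, R x y → col x ≠ col y := by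
  induction s using Finset.induction_on with
  | empty => exact ⟨fun _ => 0, by simp⟩
  | insert x s hx ih =>
    obtain ⟨col, hcol⟩ := ih fun y hy => (Finset.card_le_card
      (Finset.filter_subset_filter _ (Finset.subset_insert x s))).trans
        (hs y (Finset.mem_insert_of_mem hy))
    have hlt : ((s.filter (R x)).image col).card < (Finset.univ : Finset (Fin (D + 1))).card := by
      have h1 := (Finset.card_le_card
        (Finset.filter_subset_filter (R x) (Finset.subset_insert x s))).trans
          (hs x (Finset.mem_insert_self x s))
      have h2 := Finset.card_image_le (s := s.filter (R x)) (f := col)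
      rw [Finset.card_univ, Fintype.card_fin]
      omega
    obtain ⟨k, -, hk⟩ := Finset.exists_mem_notMem_of_card_lt_card hlt
    have hk' : ∀ y ∈ s, R x y → col y ≠ k := fun y hy hxy h =>
      hk (Finset.mem_image.2 ⟨y, Finset.mem_filter.2 ⟨hy, hxy⟩, h⟩)
    refine ⟨Function.update col x k, fun y hy z hz hyz => ?_⟩
    rcases Finset.mem_insert.1 hy with rfl | hy'
    · rcases Finset.mem_insert.1 hz with rfl | hz'
      · exact absurd hyz (hirr _)
      · have : z ≠ y := fun h => hx (h ▸ hz')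
        simpa [Function.update_of_ne this] using (hk' z hz' hyz).symm
    · have hyx : y ≠ x := fun h => hx (h ▸ hy')
      rcases Finset.mem_insert.1 hz with rfl | hz'
      · simpa [Function.update_of_ne hyx] using hk' y hy' (hR _ _ hyz)
      · have hzx : z ≠ x := fun h => hx (h ▸ hz')
        simpa [Function.update_of_ne hyx, Function.update_of_ne hzx] using hcol y hy' z hz' hyz

namespace RGraph

/-- Three edges pairwise meeting in three different vertices. -/
def IsTriangle {V : Type*} (e f g : Finset V) : Prop :=
  (e ≠ f ∧ e ≠ g ∧ f ≠ g) ∧ ∃ a b c, (a ≠ b ∧ a ≠ c ∧ b ≠ c) ∧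
    (a ∈ e ∧ a ∈ f) ∧ (b ∈ e ∧ b ∈ g) ∧ (c ∈ f ∧ c ∈ g)

theorem IsTriangle.swap {V : Type*} {e f g : Finset V} (h : IsTriangle e f g) : IsTriangle f e g := by
  obtain ⟨⟨h1, h2, h3⟩, a, b, c, ⟨hab, hac, hbc⟩, ha, hb, hc⟩ := h
  exact ⟨⟨h1.symm, h3, h2⟩, a, c, b, ⟨hac, hab, hbc.symm⟩, ha.symm, hc, hb⟩

variable {r : ℕ} {V : Type*} [DecidableEq V] {H : RGraph r V}

theorem IsLinear.edge_eq (hH : H.IsLinear) {e f : Finset V} (he : e ∈ H.edges) (hf : f ∈ H.edges)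
    {a b : V} (hab : a ≠ b) (hae : a ∈ e) (hbe : b ∈ e) (haf : a ∈ f) (hbf : b ∈ f) : e = f := by
  by_contra hne
  exact hab (Finset.card_le_one.1 (hH e he f hf hne) a (Finset.mem_inter.2 ⟨hae, haf⟩) b
    (Finset.mem_inter.2 ⟨hbe, hbf⟩))

/-- Four distinct edges of a linear hypergraph, cyclically intersecting and with disjoint
opposite pairs, form a linear four-cycle. -/
theorem IsLinear.containsLinearCycle_four (hH : H.IsLinear) {e₁ e₂ e₃ e₄ : Finset V}
    (h₁ : e₁ ∈ H.edges) (h₂ : e₂ ∈ H.edges) (h₃ : e₃ ∈ H.edges) (h₄ : e₄ ∈ H.edges)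
    (h12 : e₁ ≠ e₂) (h23 : e₂ ≠ e₃) (h34 : e₃ ≠ e₄) (h41 : e₄ ≠ e₁) (h13 : e₁ ≠ e₃) (h24 : e₂ ≠ e₄)
    (i12 : (e₁ ∩ e₂).Nonempty) (i23 : (e₂ ∩ e₃).Nonempty) (i34 : (e₃ ∩ e₄).Nonempty)
    (i41 : (e₄ ∩ e₁).Nonempty) (d13 : e₁ ∩ e₃ = ∅) (d24 : e₂ ∩ e₄ = ∅) :
    H.ContainsLinearCycle 4 := by
  have one : ∀ {e f : Finset V}, e ∈ H.edges → f ∈ H.edges → e ≠ f → (e ∩ f).Nonempty →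
      (e ∩ f).card = 1 := fun he hf hne hi =>
    le_antisymm (hH _ he _ hf hne) (Finset.card_pos.2 hi)
  have d31 : e₃ ∩ e₁ = ∅ := by rw [Finset.inter_comm, d13]
  have d42 : e₄ ∩ e₂ = ∅ := by rw [Finset.inter_comm, d24]
  refine ⟨![e₁, e₂, e₃, e₄], ?_, ?_, ?_, ?_⟩
  · intro i
    fin_cases i <;> assumption
  · intro i j hij
    fin_cases i <;> fin_cases j <;> simp_all
  · intro i
    fin_cases i
    · exact one h₁ h₂ h12 i12
    · exact one h₂ h₃ h23 i23
    · exact one h₃ h₄ h34 i34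
    · exact one h₄ h₁ h41 i41
  · intro i j hij hj hi
    fin_cases i <;> fin_cases j <;>
      first
      | exact absurd rfl hij
      | exact absurd rfl hj
      | exact absurd rfl hi
      | assumption

/-- The edges through `c` that meet `f`. -/
def edgesThroughMeeting (H : RGraph r V) (c : V) (f : Finset V) : Finset (Finset V) :=
  H.edges.filter fun g => c ∈ g ∧ (f ∩ g).Nonempty

/-- By linearity, an edge through c is determined by any vertex in which it meets f, as that vertex
differs from c. -/
theorem IsLinear.card_edgesThroughMeeting_le (hH : H.IsLinear) {c : V} {f : Finset V}
    (hc : c ∉ f) : (H.edgesThroughMeeting c f).card ≤ f.card := by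
  have hex : ∀ g ∈ H.edgesThroughMeeting c f, ∃ w, w ∈ f ∩ g := fun g hg =>
    (Finset.mem_filter.1 hg).2.2
  have : Nonempty V := ⟨c⟩
  choose! w hw using hex
  refine Finset.card_le_card_of_injOn w (fun g hg => (Finset.mem_inter.1 (hw g hg)).1) ?_
  intro g hg g' hg' h
  have h1 := Finset.mem_inter.1 (hw g hg)
  have h2 := Finset.mem_inter.1 (hw g' hg')
  have h3 := Finset.mem_filter.1 hg
  have h4 := Finset.mem_filter.1 hg'
  exact hH.edge_eq h3.1 h4.1 (a := c) (b := w g) (fun h => hc (h ▸ h1.1)) h3.2.1 h1.2 h4.2.1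
    (h ▸ h2.2)

/-- The pairs of intersecting edges `(f, g)` that form a path from `a` to `c`. -/
def pathPairs (H : RGraph r V) (a c : V) : Finset (Finset V × Finset V) :=
  (H.edges ×ˢ H.edges).filter fun p =>
    a ∈ p.1 ∧ c ∉ p.1 ∧ c ∈ p.2 ∧ a ∉ p.2 ∧ (p.1 ∩ p.2).Nonempty

theorem mem_pathPairs {a c : V} {f g : Finset V} : (f, g) ∈ H.pathPairs a c ↔
    (f ∈ H.edges ∧ g ∈ H.edges) ∧ a ∈ f ∧ c ∉ f ∧ c ∈ g ∧ a ∉ g ∧ (f ∩ g).Nonempty := by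
  simp [pathPairs]

/-- Without linear four-cycles, the number of paths of length two between two vertices is
bounded. -/
theorem IsLinear.card_pathPairs_le (hH : H.IsLinear) (hC : ¬ H.ContainsLinearCycle 4) (a c : V) :
    (H.pathPairs a c).card ≤ 2 * r ^ 2 := by
  rcases (H.pathPairs a c).eq_empty_or_nonempty with h | ⟨⟨f₁, g₁⟩, hp⟩
  · simp [h]
  obtain ⟨⟨hf₁, hg₁⟩, haf₁, hcf₁, hcg₁, hag₁, hi₁⟩ := mem_pathPairs.1 hp
  set S := (H.edgesThroughMeeting c f₁).filter (a ∉ ·) with hS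
  set T := (H.edgesThroughMeeting a g₁).filter (c ∉ ·) with hT
  have hSc : S.card ≤ r := (Finset.card_filter_le _ _).trans
    ((hH.card_edgesThroughMeeting_le hcf₁).trans (H.uniform _ hf₁).le)
  have hTc : T.card ≤ r := (Finset.card_filter_le _ _).trans
    ((hH.card_edgesThroughMeeting_le hag₁).trans (H.uniform _ hg₁).le)
  have hsub : H.pathPairs a c ⊆
      S.biUnion (fun g => H.edgesThroughMeeting a g ×ˢ {g}) ∪
      T.biUnion (fun f => {f} ×ˢ H.edgesThroughMeeting c f) := by
    rintro ⟨f, g⟩ hfg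
    obtain ⟨⟨hf, hg⟩, haf, hcf, hcg, hag, hi⟩ := mem_pathPairs.1 hfg
    -- Otherwise f₁, g₁, g, f is a linear four-cycle. So one edge of the new path meets the fixed
    -- path away from their shared end: at most r choices, then at most r for the other edge.
    have hor : (f₁ ∩ g).Nonempty ∨ (g₁ ∩ f).Nonempty := by
      by_contra! hcon
      obtain ⟨h1, h2⟩ := hcon
      refine hC (hH.containsLinearCycle_four hf₁ hg₁ hg hf ?_ ?_ ?_ ?_ ?_ ?_ hi₁
        ⟨c, Finset.mem_inter.2 ⟨hcg₁, hcg⟩⟩ (by rwa [Finset.inter_comm])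
        ⟨a, Finset.mem_inter.2 ⟨haf, haf₁⟩⟩ h1 h2)
      · rintro rfl; exact hag₁ haf₁
      · rintro rfl; exact hi₁.ne_empty h1
      · rintro rfl; exact hag haf
      · rintro rfl; exact hi.ne_empty h1
      · rintro rfl; exact hag haf₁
      · rintro rfl; exact hag₁ haf
    rw [Finset.mem_union]
    rcases hor with h | h
    · left
      simp only [Finset.mem_biUnion, Finset.mem_product, Finset.mem_singleton, hS,
        Finset.mem_filter, edgesThroughMeeting]
      exact ⟨g, ⟨⟨hg, hcg, h⟩, hag⟩, ⟨hf, haf, by rwa [Finset.inter_comm]⟩, rfl⟩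
    · right
      simp only [Finset.mem_biUnion, Finset.mem_product, Finset.mem_singleton, hT,
        Finset.mem_filter, edgesThroughMeeting]
      exact ⟨f, ⟨⟨hf, haf, h⟩, hcf⟩, rfl, hg, hcg, hi⟩
  refine (Finset.card_le_card hsub).trans ((Finset.card_union_le _ _).trans ?_)
  have h1 : (S.biUnion (fun g => H.edgesThroughMeeting a g ×ˢ {g})).card ≤ S.card * r := by
    refine Finset.card_biUnion_le_card_mul _ _ _ fun g hg => ?_
    obtain ⟨hg, hag⟩ := Finset.mem_filter.1 hg
    rw [Finset.card_product, Finset.card_singleton, mul_one]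
    exact (hH.card_edgesThroughMeeting_le hag).trans (H.uniform _ (Finset.mem_filter.1 hg).1).le
  have h2 : (T.biUnion (fun f => {f} ×ˢ H.edgesThroughMeeting c f)).card ≤ T.card * r := by
    refine Finset.card_biUnion_le_card_mul _ _ _ fun f hf => ?_
    obtain ⟨hf, hcf⟩ := Finset.mem_filter.1 hf
    rw [Finset.card_product, Finset.card_singleton, one_mul]
    exact (hH.card_edgesThroughMeeting_le hcf).trans (H.uniform _ (Finset.mem_filter.1 hf).1).le
  have h3 : S.card * r ≤ r * r := Nat.mul_le_mul_right _ hSc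
  have h4 : T.card * r ≤ r * r := Nat.mul_le_mul_right _ hTc
  nlinarith

open scoped Classical in
/-- Without linear four-cycles, an edge is in a triangle with a bounded number of edges. -/
theorem IsLinear.card_triangle_neighbors_le (hH : H.IsLinear) (hC : ¬ H.ContainsLinearCycle 4)
    {e : Finset V} (he : e ∈ H.edges) :
    (H.edges.filter fun f => ∃ g ∈ H.edges, IsTriangle e f g).card ≤ 2 * r ^ 4 := by
  -- The other two edges of a triangle form a path between two vertices of e; there are r² ordered
  -- pairs of ends.
  have hsub : (H.edges.filter fun f => ∃ g ∈ H.edges, IsTriangle e f g) ⊆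
      (e ×ˢ e).biUnion fun p => (H.pathPairs p.1 p.2).image Prod.fst := by
    intro f hf
    obtain ⟨hf, g, hg, ⟨hef, heg, hfg⟩, a, b, c, ⟨hab, hac, hbc⟩, ha, hb, hc⟩ :=
      Finset.mem_filter.1 hf
    refine Finset.mem_biUnion.2 ⟨(a, b), Finset.mem_product.2 ⟨ha.1, hb.1⟩,
      Finset.mem_image.2 ⟨(f, g), mem_pathPairs.2 ⟨⟨hf, hg⟩, ha.2, ?_, hb.2, ?_,
        c, Finset.mem_inter.2 hc⟩, rfl⟩⟩
    · exact fun hbf => hef (hH.edge_eq he hf hab ha.1 hb.1 ha.2 hbf)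
    · exact fun hag => heg (hH.edge_eq he hg hab ha.1 hb.1 hag hb.2)
  refine (Finset.card_le_card hsub).trans ((Finset.card_biUnion_le_card_mul _ _ (2 * r ^ 2)
    fun p _ => Finset.card_image_le.trans (hH.card_pathPairs_le hC _ _)).trans (le_of_eq ?_))
  rw [Finset.card_product, H.uniform e he]
  ring

/-- The edges can be coloured with boundedly many colours without monochromatic triangles. -/
theorem IsLinear.exists_triangleFree_coloring (hH : H.IsLinear)
    (hC : ¬ H.ContainsLinearCycle 4) : ∃ col : Finset V → Fin (2 * r ^ 4 + 1),
      ∀ e ∈ H.edges, ∀ f ∈ H.edges, ∀ g ∈ H.edges, IsTriangle e f g → col e ≠ col f := by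
  classical
  obtain ⟨col, hcol⟩ := exists_greedy_coloring (fun e f => ∃ g ∈ H.edges, IsTriangle e f g)
    (fun e f ⟨g, hg, h⟩ => ⟨g, hg, h.swap⟩) (fun e ⟨g, _, h⟩ => h.1.1 rfl) (2 * r ^ 4) H.edges
    (fun e he => hH.card_triangle_neighbors_le hC he)
  exact ⟨col, fun e he f hf g hg h => hcol e he f hf ⟨g, hg, h⟩⟩

/-! ### Encoding by C₄-free graphs -/

/-- In a linear hypergraph without triangles and linear four-cycles, selecting a pair of vertices
from each edge yields a graph without four-cycles. -/
theorem IsLinear.c4Free_fromRel (hH : H.IsLinear) (hC : ¬ H.ContainsLinearCycle 4)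
    {T : Set (Finset V)} (hTH : T ⊆ H.edges)
    (hT : ∀ e ∈ T, ∀ f ∈ T, ∀ g ∈ T, ¬ IsTriangle e f g) (ρ : Finset V → V → V → Prop)
    (hρ : ∀ e a b, ρ e a b → a ∈ e ∧ b ∈ e)
    (hρu : ∀ e a b a' b', ρ e a b → ρ e a' b' → a = a' ∧ b = b') :
    (SimpleGraph.fromRel fun a b => ∃ e ∈ T, ρ e a b).C4Free := by
  have hadj : ∀ {a b}, (SimpleGraph.fromRel fun a b => ∃ e ∈ T, ρ e a b).Adj a b →
      a ≠ b ∧ ∃ e ∈ T, (ρ e a b ∨ ρ e b a) ∧ a ∈ e ∧ b ∈ e := by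
    rintro a b ⟨hab, ⟨e, he, h⟩ | ⟨e, he, h⟩⟩
    · exact ⟨hab, e, he, Or.inl h, hρ _ _ _ h⟩
    · exact ⟨hab, e, he, Or.inr h, (hρ _ _ _ h).symm⟩
  have huniq : ∀ {e a b a' b'}, (ρ e a b ∨ ρ e b a) → (ρ e a' b' ∨ ρ e b' a') →
      (a = a' ∧ b = b') ∨ (a = b' ∧ b = a') := by
    rintro e a b a' b' (h | h) (h' | h') <;> have := hρu _ _ _ _ _ h h' <;> tauto
  intro a c b d hac h1 h2 h4 h3
  by_contra hbd
  obtain ⟨hab, e₁, he₁, hr₁, ha1, hb1⟩ := hadj h1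
  obtain ⟨hcb, e₂, he₂, hr₂, hc2, hb2⟩ := hadj h2
  obtain ⟨hcd, e₃, he₃, hr₃, hc3, hd3⟩ := hadj h3
  obtain ⟨had, e₄, he₄, hr₄, ha4, hd4⟩ := hadj h4
  have h12 : e₁ ≠ e₂ := by
    rintro rfl
    rcases huniq hr₁ hr₂ with h | h
    exacts [hac h.1, hab h.1]
  have h23 : e₂ ≠ e₃ := by
    rintro rfl
    rcases huniq hr₂ hr₃ with h | h
    exacts [hbd h.2, hcd h.1]
  have h34 : e₃ ≠ e₄ := by
    rintro rfl
    rcases huniq hr₃ hr₄ with h | h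
    exacts [hac h.1.symm, hcd h.1]
  have h41 : e₄ ≠ e₁ := by
    rintro rfl
    rcases huniq hr₄ hr₁ with h | h
    exacts [hbd h.2.symm, hab h.1]
  have h13 : e₁ ≠ e₃ := by
    rintro rfl
    rcases huniq hr₁ hr₃ with h | h
    exacts [hac h.1, had h.1]
  have h24 : e₂ ≠ e₄ := by
    rintro rfl
    rcases huniq hr₂ hr₄ with h | h
    exacts [hac h.1.symm, hcd h.1]
  -- A common vertex of e₁ and e₃ would make e₁, e₂, e₃ a triangle; linearity keeps its corners
  -- distinct.
  have d13 : e₁ ∩ e₃ = ∅ := by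
    rw [Finset.eq_empty_iff_forall_notMem]
    intro v hv
    rw [Finset.mem_inter] at hv
    refine hT _ he₁ _ he₂ _ he₃ ⟨⟨h12, h13, h23⟩, b, v, c, ⟨?_, hcb.symm, ?_⟩, ⟨hb1, hb2⟩, hv,
      hc2, hc3⟩
    · rintro rfl
      exact h23 (hH.edge_eq (hTH he₂) (hTH he₃) hcb hc2 hb2 hc3 hv.2)
    · rintro rfl
      exact h12 (hH.edge_eq (hTH he₁) (hTH he₂) hcb hv.1 hb1 hc2 hb2)
  have d24 : e₂ ∩ e₄ = ∅ := by
    rw [Finset.eq_empty_iff_forall_notMem]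
    intro v hv
    rw [Finset.mem_inter] at hv
    refine hT _ he₁ _ he₂ _ he₄ ⟨⟨h12, h41.symm, h24⟩, b, a, v, ⟨hab.symm, ?_, ?_⟩, ⟨hb1, hb2⟩,
      ⟨ha1, ha4⟩, hv⟩
    · rintro rfl
      exact h41 (hH.edge_eq (hTH he₄) (hTH he₁) hab ha4 hv.2 ha1 hb1)
    · rintro rfl
      exact h12 (hH.edge_eq (hTH he₁) (hTH he₂) hab ha1 hb1 hv.1 hb2)
  exact hC (hH.containsLinearCycle_four (hTH he₁) (hTH he₂) (hTH he₃) (hTH he₄) h12 h23 h34 h41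
    h13 h24 ⟨b, Finset.mem_inter.2 ⟨hb1, hb2⟩⟩ ⟨c, Finset.mem_inter.2 ⟨hc2, hc3⟩⟩
    ⟨d, Finset.mem_inter.2 ⟨hd3, hd4⟩⟩ ⟨a, Finset.mem_inter.2 ⟨ha4, ha1⟩⟩ d13 d24)

/-- In a linear hypergraph, an `r`-clique of the shadow of a triangle-free set of edges is an
edge. -/
theorem IsLinear.mem_of_clique (hH : H.IsLinear) (hr : 2 ≤ r) {T : Set (Finset V)}
    (hTH : T ⊆ H.edges) (hT : ∀ e ∈ T, ∀ f ∈ T, ∀ g ∈ T, ¬ IsTriangle e f g) {e : Finset V}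
    (he : e.card = r) (hcl : ∀ a ∈ e, ∀ b ∈ e, a ≠ b → ∃ f ∈ T, a ∈ f ∧ b ∈ f) : e ∈ T := by
  obtain ⟨a, ha, b, hb, hab⟩ := Finset.one_lt_card.1 (show 1 < e.card by omega)
  obtain ⟨f, hf, haf, hbf⟩ := hcl a ha b hb hab
  suffices hsub : e ⊆ f by
    rwa [Finset.eq_of_subset_of_card_le hsub (by rw [he, H.uniform f (hTH hf)])]
  intro c hc
  by_contra hcf
  have hac : a ≠ c := fun h => hcf (h ▸ haf)
  have hbc : b ≠ c := fun h => hcf (h ▸ hbf)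
  obtain ⟨g, hg, hag, hcg⟩ := hcl a ha c hc hac
  obtain ⟨h, hh, hbh, hch⟩ := hcl b hb c hc hbc
  -- If c lay outside f, the edges covering ab, ac and bc would form a forbidden triangle.
  refine hT f hf g hg h hh ⟨⟨?_, ?_, ?_⟩, a, b, c, ⟨hab, hac, hbc⟩, ⟨haf, hag⟩, ⟨hbf, hbh⟩,
    hcg, hch⟩
  · rintro rfl; exact hcf hcg
  · rintro rfl; exact hcf hch
  · rintro rfl
    exact hcf (hH.edge_eq (hTH hg) (hTH hf) hab hag hbh haf hbf ▸ hcg)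

open scoped Classical in
/-- A linear hypergraph without linear four-cycles is encoded by boundedly many `C₄`-free
graphs. -/
theorem ncard_forbL_four_le (n : ℕ) (hr : 2 ≤ r) : (ForbL n r 4).ncard ≤
    ({G : SimpleGraph (Fin n) | G.C4Free} : Finset _).card ^ ((2 * r ^ 4 + 1) * (r * r)) := by
  have hex : ∀ H : ForbL n r 4, ∃ col : Finset (Fin n) → Fin (2 * r ^ 4 + 1),
      ∀ e ∈ H.1.edges, ∀ f ∈ H.1.edges, ∀ g ∈ H.1.edges, IsTriangle e f g → col e ≠ col f :=
    fun H => H.2.1.exists_triangleFree_coloring H.2.2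
  choose col hcol using hex
  let T : ForbL n r 4 → Fin (2 * r ^ 4 + 1) → Set (Finset (Fin n)) :=
    fun H k => {e | e ∈ H.1.edges ∧ col H e = k}
  have hTH : ∀ H k, T H k ⊆ H.1.edges := fun H k e he => he.1
  have hT : ∀ H k, ∀ e ∈ T H k, ∀ f ∈ T H k, ∀ g ∈ T H k, ¬ IsTriangle e f g :=
    fun H k e he f hf g hg h => hcol H e he.1 f hf.1 g hg.1 h (he.2.trans hf.2.symm)
  -- Positions in the increasing order of Fin n select one pair per edge; all (p, q) together cover
  -- the shadow.
  let ρ : Fin r → Fin r → Finset (Fin n) → Fin n → Fin n → Prop := fun p q e a b =>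
    ∃ h : e.card = r, e.orderEmbOfFin h p = a ∧ e.orderEmbOfFin h q = b
  have hρ : ∀ p q e a b, ρ p q e a b → a ∈ e ∧ b ∈ e := by
    rintro p q e a b ⟨h, rfl, rfl⟩
    exact ⟨Finset.orderEmbOfFin_mem _ _ _, Finset.orderEmbOfFin_mem _ _ _⟩
  have hρu : ∀ p q e a b a' b', ρ p q e a b → ρ p q e a' b' → a = a' ∧ b = b' := by
    rintro p q e a b a' b' ⟨h, rfl, rfl⟩ ⟨h', rfl, rfl⟩
    exact ⟨rfl, rfl⟩
  let Φ : ForbL n r 4 → (Fin (2 * r ^ 4 + 1) × (Fin r × Fin r) →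
      {G : SimpleGraph (Fin n) // G.C4Free}) := fun H i =>
    ⟨SimpleGraph.fromRel fun a b => ∃ e ∈ T H i.1, ρ i.2.1 i.2.2 e a b,
      H.2.1.c4Free_fromRel H.2.2 (hTH H i.1) (hT H i.1) _ (hρ _ _) (hρu _ _)⟩
  have hsub : ∀ H H', Φ H = Φ H' → H.1.edges ⊆ H'.1.edges := by
    intro H H' hΦ e he
    have hcard := H.1.uniform e he
    -- The colourings of H and H' may differ, but equal codes make e a clique in the shadow of the
    -- class of H' with the same index.
    refine hTH H' (col H e) (H'.2.1.mem_of_clique hr (hTH H' _) (hT H' _) hcard ?_)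
    intro a ha b hb hab
    obtain ⟨p, rfl⟩ : ∃ p, e.orderEmbOfFin hcard p = a := by
      rw [← Set.mem_range, Finset.range_orderEmbOfFin]; exact ha
    obtain ⟨q, rfl⟩ : ∃ q, e.orderEmbOfFin hcard q = b := by
      rw [← Set.mem_range, Finset.range_orderEmbOfFin]; exact hb
    have hadj : (Φ H (col H e, p, q)).1.Adj (e.orderEmbOfFin hcard p) (e.orderEmbOfFin hcard q) :=
      ⟨hab, Or.inl ⟨e, ⟨he, rfl⟩, hcard, rfl, rfl⟩⟩
    rw [hΦ] at hadj
    obtain ⟨-, ⟨f, hf, h⟩ | ⟨f, hf, h⟩⟩ := hadj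
    · exact ⟨f, hf, hρ _ _ _ _ _ h⟩
    · exact ⟨f, hf, (hρ _ _ _ _ _ h).symm⟩
  have hinj : Function.Injective Φ := fun H H' h =>
    Subtype.ext (RGraph.ext ((hsub H H' h).antisymm (hsub H' H h.symm)))
  have := Nat.card_le_card_of_injective Φ hinj
  rw [Nat.card_coe_set_eq] at this
  simpa [Nat.card_eq_fintype_card, Fintype.card_subtype] using this

end RGraph

theorem theorem1 (r : ℕ) (hr : 3 ≤ r) :
    ∃ C : ℝ, 0 < C ∧ ∀ n : ℕ,
      ((RGraph.ForbL n r 4).ncard : ℝ) ≤ (2 : ℝ) ^ (C * (n : ℝ) ^ (3 / 2 : ℝ)) := by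
  classical
  set N : ℕ := (2 * r ^ 4 + 1) * (r * r) with hN
  have hNpos : 0 < N := by positivity
  have hlog : 0 < Real.log 2 := Real.log_pos (by norm_num)
  -- N graphs contribute 9004 each to the exponent; dividing by log 2 changes the base from e to 2.
  refine ⟨9004 * N / Real.log 2, by positivity, fun n => ?_⟩
  have h := RGraph.ncard_forbL_four_le (r := r) n (by omega)
  calc ((RGraph.ForbL n r 4).ncard : ℝ)
      ≤ (({G : SimpleGraph (Fin n) | G.C4Free} : Finset _).card : ℝ) ^ N := by exact_mod_cast h
    _ ≤ Real.exp (9004 * (n : ℝ) ^ (3 / 2 : ℝ)) ^ N := by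
      gcongr
      exact card_c4Free_le n
    _ = (2 : ℝ) ^ (9004 * N / Real.log 2 * (n : ℝ) ^ (3 / 2 : ℝ)) := by
      generalize (n : ℝ) ^ (3 / 2 : ℝ) = x
      rw [← Real.exp_nat_mul, Real.rpow_def_of_pos (by norm_num)]
      congr 1
      field_simp
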